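/- Let $n\ge k\ge 1$ and let $\mathcal{OP}_n^k$ be the set of ordered partitions $\pi=B_1/B_2/\cdots/B_k$ of $[n]=\{1,\dots,n\}$ into $k$ (nonempty, pairwise disjoint) blocks. Let $w_i$ be the index of the block containing $i$, let $\operatorname{open}\pi$ and $\operatorname{clos}\pi$ be the sets of least, respectively greatest, elements of the blocks, and put $$\operatorname{ros}\pi=\sum_{i=1}^n\#\{j\in\operatorname{open}\pi: j<i,\ w_j>w_i\},\qquad \operatorname{lob}\pi=\sum_{i=1}^n\#\{j\in\operatorname{open}\pi: j>i,\ w_j<w_i\},$$ $$\operatorname{lcs}\pi=\sum_{i=1}^n\#\{j\in\operatorname{clos}\pi: j<i,\ w_j<w_i\},\qquad \operatorname{rcb}\pi=\sum_{i=1}^n\#\{j\in\operatorname{clos}\pi: j>i,\ w_j>w_i\},$$ $$\operatorname{lsb}\pi=\sum_{i=1}^n\#\{b: b<w_i,\ \min B_b<i<\max B_b\}.$$ Let $\operatorname{bMaj}\pi$ be the sum of all $b\in\{1,\dots,k-1\}$ such that every element of $B_b$ is greater than every element of $B_{b+1}$, and let $$\mathrm{MAK}=\operatorname{ros}+\operatorname{lcs},\qquad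 \mathrm{MAK}'=\operatorname{lob}+\operatorname{rcb},\qquad \operatorname{cmajLSB}=\operatorname{lsb}+\Big(\tbinom k2-\operatorname{bMaj}\Big)+\tbinom k2 .$$ Let $[k]_{p,q}=\sum_{j=0}^{k-1}p^{k-1-j}q^{j}$ and $[k]_{p,q}!=[1]_{p,q}[2]_{p,q}\cdots[k]_{p,q}$, and define $S_{p,q}(n,k)$ by $S_{p,q}(0,0)=1$, $$S_{p,q}(n,k)=p^{k-1}S_{p,q}(n-1,k-1)+[k]_{p,q}\,S_{p,q}(n-1,k)\quad\text{if } 0<k\le n,$$ and $S_{p,q}(n,k)=0$ in all other cases. Write $[k]_q=1+q+\cdots+q^{k-1}$, $[k]_q!=[1]_q\cdots[k]_q$ and $S_q(n,k)=S_{q,1}(n,k)$. **Theorem.** For all $n\ge k\ge 1$ and for each $\mathrm{maf}\in\{\mathrm{MAK},\mathrm{MAK}'\}$, $$\sum_{\pi\in\mathcal{OP}_n^k}p^{(\mathrm{maf}+\operatorname{bMaj})\pi}\,q^{\operatorname{cmajLSB}\pi}=q^{\binom k2}\,[k]_{p,q}!\,S_{p,q}(n,k),$$ as an identity of polynomials in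 $p,q$ (equivalently, for all elements $p,q$ of every commutative semiring). In particular, each of the three statistics $\mathrm{stat}\in\{\mathrm{MAK}+\operatorname{bMaj},\ \mathrm{MAK}'+\operatorname{bMaj},\ \operatorname{cmajLSB}\}$ is Euler–Mahonian, that is, for all $n\ge k\ge1$, $$\sum_{\pi\in\mathcal{OP}_n^k}q^{\mathrm{stat}\,\pi}=[k]_q!\,S_q(n,k).$$ -/

import Mathlib

open Finset Polynomial

/-- Ordered partitions of `[n]` into `k` blocks: sequences `B_1 / B_2 / ⋯ / B_k` of pairwise
disjoint nonempty subsets whose union is `[n]`. The letters `1 < 2 < ⋯ < n` and the block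
positions `1, …, k` are represented by `Fin n` and `Fin k` (shifted by one, order preserved). -/
def OrdPartition (n k : ℕ) : Type :=
  {B : Fin k → Finset (Fin n) //
    (∀ b, (B b).Nonempty) ∧ (∀ b c, b ≠ c → Disjoint (B b) (B c)) ∧
      (univ : Finset (Fin k)).biUnion B = univ}

namespace OrdPartition

variable {n k : ℕ}

instance : Fintype (OrdPartition n k) :=
  inferInstanceAs (Fintype {B : Fin k → Finset (Fin n) //
    (∀ b, (B b).Nonempty) ∧ (∀ b c, b ≠ c → Disjoint (B b) (B c)) ∧
      (univ : Finset (Fin k)).biUnion B = univ})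

/-- The `b`-th block. -/
def block (π : OrdPartition n k) (b : Fin k) : Finset (Fin n) := π.1 b

theorem block_nonempty (π : OrdPartition n k) (b : Fin k) : (π.block b).Nonempty := π.2.1 b

theorem existsUnique_mem_block (π : OrdPartition n k) (i : Fin n) :
    ∃! b, b ∈ (univ : Finset (Fin k)) ∧ i ∈ π.block b := by
  have hi : i ∈ (univ : Finset (Fin k)).biUnion π.1 := by
    rw [π.2.2.2]
    exact mem_univ i
  obtain ⟨b, hb, hib⟩ := mem_biUnion.mp hi
  refine ⟨b, ⟨hb, hib⟩, ?_⟩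
  rintro c ⟨-, hic⟩
  by_contra hne
  exact Finset.disjoint_left.mp (π.2.2.1 c b hne) hic hib

/-- `w_i`: the index of the block containing the letter `i`. -/
def w (π : OrdPartition n k) (i : Fin n) : Fin k :=
  Finset.choose (fun b => i ∈ π.block b) univ (π.existsUnique_mem_block i)

/-- The opener (least element) of the `b`-th block. -/
def opener (π : OrdPartition n k) (b : Fin k) : Fin n := (π.block b).min' (π.block_nonempty b)

/-- The closer (greatest element) of the `b`-th block. -/
def closer (π : OrdPartition n k) (b : Fin k) : Fin n := (π.block b).max' (π.block_nonempty b)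

/-- The set of openers of the blocks. -/
def openers (π : OrdPartition n k) : Finset (Fin n) := univ.image π.opener

/-- The set of closers of the blocks. -/
def closers (π : OrdPartition n k) : Finset (Fin n) := univ.image π.closer

/-- "right, opener, smaller" at the letter `i`. -/
def rosAt (π : OrdPartition n k) (i : Fin n) : ℕ :=
  (π.openers.filter fun j => j < i ∧ π.w i < π.w j).card

/-- "left, opener, bigger" at the letter `i`. -/
def lobAt (π : OrdPartition n k) (i : Fin n) : ℕ :=
  (π.openers.filter fun j => i < j ∧ π.w j < π.w i).card

/-- "left, closer, smaller" at the letter `i`. -/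
def lcsAt (π : OrdPartition n k) (i : Fin n) : ℕ :=
  (π.closers.filter fun j => j < i ∧ π.w j < π.w i).card

/-- "right, closer, bigger" at the letter `i`. -/
def rcbAt (π : OrdPartition n k) (i : Fin n) : ℕ :=
  (π.closers.filter fun j => i < j ∧ π.w i < π.w j).card

/-- The number of blocks to the left of the block containing `i` whose opener is smaller than `i`
and whose closer is greater than `i`. -/
def lsbAt (π : OrdPartition n k) (i : Fin n) : ℕ :=
  ((univ : Finset (Fin k)).filter fun b => b < π.w i ∧ π.opener b < i ∧ i < π.closer b).card

def ros (π : OrdPartition n k) : ℕ := ∑ i, π.rosAt i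

def lob (π : OrdPartition n k) : ℕ := ∑ i, π.lobAt i

def lcs (π : OrdPartition n k) : ℕ := ∑ i, π.lcsAt i

def rcb (π : OrdPartition n k) : ℕ := ∑ i, π.rcbAt i

def lsb (π : OrdPartition n k) : ℕ := ∑ i, π.lsbAt i

/-- `B_b ≻ B_c`: every letter of `B_b` is greater than every letter of `B_c`. -/
def BlockGT (π : OrdPartition n k) (b c : Fin k) : Prop :=
  ∀ x ∈ π.block b, ∀ y ∈ π.block c, y < x

instance (π : OrdPartition n k) (b c : Fin k) : Decidable (π.BlockGT b c) :=
  inferInstanceAs (Decidable (∀ x ∈ π.block b, ∀ y ∈ π.block c, y < x))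

/-- The position `b` is a block descent: there is a next block, and `B_b ≻ B_{b+1}`. -/
def IsBlockDescent (π : OrdPartition n k) (b : Fin k) : Prop :=
  ∃ h : (b : ℕ) + 1 < k, π.BlockGT b ⟨(b : ℕ) + 1, h⟩

instance (π : OrdPartition n k) (b : Fin k) : Decidable (π.IsBlockDescent b) :=
  inferInstanceAs (Decidable (∃ h : (b : ℕ) + 1 < k, π.BlockGT b ⟨(b : ℕ) + 1, h⟩))

/-- The block major index: the sum of the block descents. The position `b : Fin k` is counted
as `b + 1`, since the blocks of a partition are numbered from `1`. -/
def bMaj (π : OrdPartition n k) : ℕ :=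
  ∑ b ∈ (univ : Finset (Fin k)).filter (fun b => π.IsBlockDescent b), ((b : ℕ) + 1)

/-- The subtraction in the definition of `cbMaj` never truncates. -/
theorem bMaj_le (π : OrdPartition n k) : π.bMaj ≤ k.choose 2 := by
  have hsub : ((univ : Finset (Fin k)).filter (fun b => π.IsBlockDescent b)).image
      (fun b : Fin k => (b : ℕ) + 1) ⊆ range k := by
    intro m hm
    obtain ⟨b, hb, rfl⟩ := mem_image.mp hm
    obtain ⟨h, -⟩ := (mem_filter.mp hb).2
    exact mem_range.mpr h
  calc π.bMaj
      = ∑ m ∈ ((univ : Finset (Fin k)).filter (fun b => π.IsBlockDescent b)).image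
          (fun b : Fin k => (b : ℕ) + 1), m := by
        rw [bMaj, sum_image]
        intro a _ b _ hab
        exact Fin.ext (Nat.succ_injective hab)
    _ ≤ ∑ m ∈ range k, m := sum_le_sum_of_subset hsub
    _ = k.choose 2 := by rw [sum_range_id, Nat.choose_two_right]

/-- The complement of the block major index. -/
def cbMaj (π : OrdPartition n k) : ℕ := k.choose 2 - π.bMaj

def cmajLSB (π : OrdPartition n k) : ℕ := π.lsb + π.cbMaj + k.choose 2

def MAK (π : OrdPartition n k) : ℕ := π.ros + π.lcs

def MAK' (π : OrdPartition n k) : ℕ := π.lob + π.rcb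

end OrdPartition

/-- `[k]_{p,q} = p^{k-1} + p^{k-2} q + ⋯ + p q^{k-2} + q^{k-1}`. -/
def pqNat {R : Type*} [CommSemiring R] (p q : R) (k : ℕ) : R :=
  ∑ j ∈ range k, p ^ (k - 1 - j) * q ^ j

/-- `[k]_{p,q}! = [1]_{p,q} [2]_{p,q} ⋯ [k]_{p,q}`. -/
def pqFactorial {R : Type*} [CommSemiring R] (p q : R) (k : ℕ) : R :=
  ∏ j ∈ Finset.Icc 1 k, pqNat p q j

/-- The `p,q`-Stirling numbers of the second kind. -/
def pqStirling {R : Type*} [CommSemiring R] (p q : R) : ℕ → ℕ → R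
  | 0, 0 => 1
  | 0, _ + 1 => 0
  | _ + 1, 0 => 0
  | n + 1, k + 1 =>
    if k + 1 ≤ n + 1 then
      p ^ k * pqStirling p q n k + pqNat p q (k + 1) * pqStirling p q n (k + 1)
    else 0

/-- `[k]_q = 1 + q + ⋯ + q^{k-1}`. -/
def qNat {R : Type*} [CommSemiring R] (q : R) (k : ℕ) : R := ∑ j ∈ range k, q ^ j

/-- `[k]_q! = [1]_q [2]_q ⋯ [k]_q`. -/
def qFactorial {R : Type*} [CommSemiring R] (q : R) (k : ℕ) : R :=
  ∏ j ∈ Finset.Icc 1 k, qNat q j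

/-- The `q`-Stirling numbers of the second kind, `S_q(n, k) = S_{q,1}(n, k)`. -/
def qStirling {R : Type*} [CommSemiring R] (q : R) (n k : ℕ) : R := pqStirling q 1 n k

/-- A statistic on ordered set partitions is Euler-Mahonian if, for all `n ≥ k ≥ 1`, its
generating polynomial over the ordered partitions of `[n]` into `k` blocks is
`[k]_q! S_q(n, k)`, as polynomials in the indeterminate `q = X`. -/
def IsEulerMahonian (stat : ∀ n k : ℕ, OrdPartition n k → ℕ) : Prop :=
  ∀ n k : ℕ, 1 ≤ k → k ≤ n →
    ∑ π : OrdPartition n k, (X : ℕ[X]) ^ stat n k π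
      = qFactorial (X : ℕ[X]) k * qStirling (X : ℕ[X]) n k

/-! An ordered partition is built letter by letter. The state is a surjective word with its set of
active blocks; let `k` be the number of blocks and `h` the number of active ones. Once no block is
active, MAK is `rsb + closedBefore` and MAK' is `rsb + openerSum` (`MAK_eq`, `MAK'_eq`). Hence one
weight `p^(rsb+maj) q^(lsb+comaj) y^closedBefore z^openerSum` serves for both, with `(y, z) = (p,
1)` and `(y, z) = (1, p)`.

Up to powers of `y` and `z`, a letter joining an active block contributes `p^(active blocks on its
right) q^(active blocks on its left)`, counting the other blocks; the choices of the block add up to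
`[h]`. A letter opening a block in one of the `k + 1` gaps raises `rsb + maj` by the label of the
gap, as in the insertion proof that the major index is Mahonian, and the labels are `0, …, k`, each
once. The four statistics in `p` and `q` together grow by `k + h`, so the gaps add up to `q^h [k+1]`
(`sum_push`, `sum_pushNew`). Only `n`, `k` and `h` survive, which gives the recursion
`partialSum_succ_succ`.

For MAK, let `L_k f` be the sum of `f h` weighted by the `p,q`-binomials `pqBinom (k-h) h`. Joining
multiplies `L_k` by `[k]`, and opening turns `L_k` into `[k+1] L_{k+1}`. What remains is the
Stirling recurrence together with a factor `[k]!` (`partialSum_closed`).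

For MAK', the word is cut after `i` letters. The beginnings, paired with an explicit generating
function `completion` for the endings, give a total independent of `i`
(`sum_partialSum_completion_succ`); the theorem compares the cuts `i = n` and `i = 0`. -/

/-! ### Words with active blocks

A partial ordered partition is a surjective word `w : Fin n → Fin k` recording the block of each
letter, together with the set `A` of active blocks, those that are still to receive letters
beyond `n`. -/

namespace BlockWord

variable {n k : ℕ}

/-- The letter `i` lies strictly between the opener and the closer of the block `b`. -/
abbrev Spans (w : Fin n → Fin k) (A : Finset (Fin k)) (i : Fin n) (b : Fin k) : Prop :=
  (∃ j, j < i ∧ w j = b) ∧ (b ∈ A ∨ ∃ j, i < j ∧ w j = b)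

/-- The number of pairs of a letter and a block on its right spanning it. -/
def rsb (w : Fin n → Fin k) (A : Finset (Fin k)) : ℕ :=
  ∑ i, ∑ b, if w i < b ∧ Spans w A i b then 1 else 0

/-- The number of pairs of a letter and a block on its left spanning it. -/
def lsb (w : Fin n → Fin k) (A : Finset (Fin k)) : ℕ :=
  ∑ i, ∑ b, if b < w i ∧ Spans w A i b then 1 else 0

/-- The number of pairs of a letter and a block closed before it. -/
def closedBefore (w : Fin n → Fin k) (A : Finset (Fin k)) : ℕ :=
  ∑ i, ∑ b, if b ∉ A ∧ ∀ j, w j = b → j < i then 1 else 0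

/-- The sum of the openers. -/
def openerSum (w : Fin n → Fin k) : ℕ :=
  ∑ i, if ∀ j, j < i → w j ≠ w i then (i : ℕ) else 0

/-- The block `r` is closed and smaller than the block immediately on its left. -/
def IsDescent (w : Fin n → Fin k) (A : Finset (Fin k)) (r : Fin k) : Prop :=
  r ∉ A ∧ ∃ l : Fin k, (l : ℕ) + 1 = r ∧ ∀ i j, w i = l → w j = r → j < i

instance (w : Fin n → Fin k) (A : Finset (Fin k)) : DecidablePred (IsDescent w A) := fun r =>
  inferInstanceAs (Decidable
    (r ∉ A ∧ ∃ l : Fin k, (l : ℕ) + 1 = r ∧ ∀ i j, w i = l → w j = r → j < i))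

/-- The block major index. -/
def maj (w : Fin n → Fin k) (A : Finset (Fin k)) : ℕ :=
  ∑ r, if IsDescent w A r then (r : ℕ) else 0

/-- The complementary block major index. -/
def comaj (w : Fin n → Fin k) (A : Finset (Fin k)) : ℕ :=
  ∑ r, if IsDescent w A r then 0 else (r : ℕ)

theorem maj_add_comaj (w : Fin n → Fin k) (A : Finset (Fin k)) :
    maj w A + comaj w A = ∑ r : Fin k, (r : ℕ) := by
  rw [maj, comaj, ← sum_add_distrib]
  exact sum_congr rfl fun r _ => by split_ifs <;> simp

/-! #### Appending a letter to an active block -/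

section Join

variable (w : Fin n → Fin k) (A : Finset (Fin k)) (b : Fin k)

/-- The word `w` followed by the letter `b`. -/
abbrev push : Fin (n + 1) → Fin k := Fin.snoc (α := fun _ => Fin k) w b

/-- Seen from an earlier letter, `b` still awaits the new letter, whether or not it closes with it.
So `insert b A` is the active set before the step, and `A` the one after. -/
theorem spans_push_castSucc (i : Fin n) (c : Fin k) :
    Spans (push w b) A i.castSucc c ↔ Spans w (insert b A) i c := by
  simp only [Spans, Fin.exists_fin_succ', push, Fin.snoc_castSucc, Fin.snoc_last,
    Fin.castSucc_lt_castSucc_iff, Fin.castSucc_lt_last, mem_insert]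
  have : ¬ Fin.last n < i.castSucc := (Fin.castSucc_lt_last i).not_gt
  simp only [this, false_and, or_false, true_and, eq_comm (a := b)]
  rw [or_comm (a := c = b), or_assoc, or_comm (a := c = b)]

theorem spans_push_last (hw : Function.Surjective w) (c : Fin k) :
    Spans (push w b) A (Fin.last n) c ↔ c ∈ A := by
  simp only [Spans, Fin.exists_fin_succ', push, Fin.snoc_castSucc, Fin.snoc_last,
    Fin.castSucc_lt_last, lt_irrefl, false_and, or_false, true_and]
  have h1 : ∃ i, w i = c := hw c
  have h2 : ¬ ∃ i : Fin n, Fin.last n < i.castSucc ∧ w i = c := by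
    rintro ⟨i, hi, -⟩
    exact (Fin.castSucc_lt_last i).not_gt hi
  simp only [h1, h2, or_false, true_and]

theorem rsb_push (hw : Function.Surjective w) :
    rsb (push w b) A = rsb w (insert b A) + #{c ∈ A | b < c} := by
  rw [rsb, Fin.sum_univ_castSucc, rsb]
  simp only [spans_push_castSucc, spans_push_last w A b hw]
  simp only [push, Fin.snoc_castSucc, Fin.snoc_last]
  rw [add_right_inj, ← card_filter]
  congr 1
  ext c
  simp [and_comm]

theorem lsb_push (hw : Function.Surjective w) :
    lsb (push w b) A = lsb w (insert b A) + #{c ∈ A | c < b} := by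
  rw [lsb, Fin.sum_univ_castSucc, lsb]
  simp only [spans_push_castSucc, spans_push_last w A b hw]
  simp only [push, Fin.snoc_castSucc, Fin.snoc_last]
  rw [add_right_inj, ← card_filter]
  congr 1
  ext c
  simp [and_comm]

theorem closedBefore_push :
    closedBefore (push w b) A = closedBefore w (insert b A) + (k - #(insert b A)) := by
  rw [closedBefore, Fin.sum_univ_castSucc, closedBefore]
  have hl : ∀ i : Fin n, ¬ Fin.last n < i.castSucc := fun i => (Fin.castSucc_lt_last i).not_gt
  simp only [Fin.forall_fin_succ', push, Fin.snoc_castSucc, Fin.snoc_last,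
    Fin.castSucc_lt_castSucc_iff, Fin.castSucc_lt_last, lt_irrefl, hl, imp_true_iff, true_and,
    mem_insert, not_or, imp_false]
  congr 1
  · refine sum_congr rfl fun i _ => sum_congr rfl fun c _ => if_congr ?_ rfl rfl
    rw [eq_comm (a := b)]
    tauto
  · rw [← card_filter, show k - #(insert b A) = #(insert b A)ᶜ by rw [card_compl, Fintype.card_fin]]
    congr 1
    ext c
    simp only [mem_filter, mem_univ, true_and, mem_compl, mem_insert, eq_comm (a := b)]
    tauto

theorem openerSum_push (hw : Function.Surjective w) : openerSum (push w b) = openerSum w := by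
  rw [openerSum, Fin.sum_univ_castSucc, openerSum]
  have hl : ∀ i : Fin n, ¬ Fin.last n < i.castSucc := fun i => (Fin.castSucc_lt_last i).not_gt
  simp only [Fin.forall_fin_succ', push, Fin.snoc_castSucc, Fin.snoc_last,
    Fin.castSucc_lt_castSucc_iff, Fin.castSucc_lt_last, lt_irrefl, hl, false_imp_iff, and_true,
    true_imp_iff]
  obtain ⟨i, hi⟩ := hw b
  rw [if_neg (fun h => h i hi), add_zero]
  rfl

/-- The block that receives the largest letter can no longer be smaller than its left neighbour,
even if it closes now; a larger letter in the left neighbour does no harm. -/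
theorem isDescent_push (hw : Function.Surjective w) (r : Fin k) :
    IsDescent (push w b) A r ↔ IsDescent w (insert b A) r := by
  have hl : ∀ i : Fin n, ¬ Fin.last n < i.castSucc := fun i => (Fin.castSucc_lt_last i).not_gt
  simp only [IsDescent, Fin.forall_fin_succ', push, Fin.snoc_castSucc, Fin.snoc_last,
    Fin.castSucc_lt_castSucc_iff, Fin.castSucc_lt_last, lt_irrefl, hl, mem_insert, not_or]
  constructor
  · rintro ⟨hr, l, hlr, h, -⟩
    obtain ⟨i, hi⟩ := hw l
    refine ⟨⟨?_, hr⟩, l, hlr, fun i j hi hj => (h i).1 j hi hj⟩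
    rintro rfl
    exact (h i).2 hi rfl
  · rintro ⟨⟨hrb, hr⟩, l, hlr, h⟩
    refine ⟨hr, l, hlr, fun i => ⟨fun j => h i j, fun _ hb => hrb hb.symm⟩,
      fun _ _ _ => trivial, fun _ hb => hrb hb.symm⟩

theorem maj_push (hw : Function.Surjective w) : maj (push w b) A = maj w (insert b A) :=
  sum_congr rfl fun r _ => if_congr (isDescent_push w A b hw r) rfl rfl

theorem comaj_push (hw : Function.Surjective w) : comaj (push w b) A = comaj w (insert b A) :=
  sum_congr rfl fun r _ => if_congr (isDescent_push w A b hw r) rfl rfl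

end Join

/-! #### Appending a letter that opens a new block -/

section Open

variable (w : Fin n → Fin k) (A : Finset (Fin k)) (b : Fin (k + 1)) (A' : Finset (Fin (k + 1)))

/-- The word `w`, with its blocks renumbered, followed by a letter in a new block at position
`b`. -/
abbrev pushNew : Fin (n + 1) → Fin (k + 1) := push (b.succAbove ∘ w) b

theorem spans_pushNew_castSucc (hA : ∀ c, b.succAbove c ∈ A' ↔ c ∈ A) (i : Fin n) (c : Fin k) :
    Spans (pushNew w b) A' i.castSucc (b.succAbove c) ↔ Spans w A i c := by
  simp only [pushNew, spans_push_castSucc]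
  simp [Spans, hA]

theorem not_spans_pushNew (i : Fin n) : ¬ Spans (pushNew w b) A' i.castSucc b := by
  simp only [pushNew, spans_push_castSucc]
  simp [Spans]

theorem spans_pushNew_last (hA : ∀ c, b.succAbove c ∈ A' ↔ c ∈ A) (hw : Function.Surjective w)
    (c : Fin k) : Spans (pushNew w b) A' (Fin.last n) (b.succAbove c) ↔ c ∈ A := by
  have hl : ∀ i : Fin n, ¬ Fin.last n < i.castSucc := fun i => (Fin.castSucc_lt_last i).not_gt
  have h1 : ∃ i, w i = c := hw c
  simp [Spans, Fin.exists_fin_succ', hA, h1, hl]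

theorem rsb_pushNew (hA : ∀ c, b.succAbove c ∈ A' ↔ c ∈ A) (hw : Function.Surjective w) :
    rsb (pushNew w b) A' = rsb w A + #{c ∈ A | b < b.succAbove c} := by
  rw [rsb, Fin.sum_univ_castSucc, rsb]
  simp only [Fin.sum_univ_succAbove _ b, not_spans_pushNew, spans_pushNew_castSucc w A b A' hA,
    spans_pushNew_last w A b A' hA hw]
  simp only [Fin.snoc_castSucc, Fin.snoc_last, Function.comp, lt_irrefl, false_and, and_false,
    if_false, zero_add, Fin.succAbove_lt_succAbove_iff]
  rw [add_right_inj, ← card_filter]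
  congr 1
  ext c
  simp [and_comm]

theorem lsb_pushNew (hA : ∀ c, b.succAbove c ∈ A' ↔ c ∈ A) (hw : Function.Surjective w) :
    lsb (pushNew w b) A' = lsb w A + #{c ∈ A | b.succAbove c < b} := by
  rw [lsb, Fin.sum_univ_castSucc, lsb]
  simp only [Fin.sum_univ_succAbove _ b, not_spans_pushNew, spans_pushNew_castSucc w A b A' hA,
    spans_pushNew_last w A b A' hA hw]
  simp only [Fin.snoc_castSucc, Fin.snoc_last, Function.comp, lt_irrefl, false_and, and_false,
    if_false, zero_add, Fin.succAbove_lt_succAbove_iff]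
  rw [add_right_inj, ← card_filter]
  congr 1
  ext c
  simp [and_comm]

theorem closedBefore_pushNew (hA : ∀ c, b.succAbove c ∈ A' ↔ c ∈ A) :
    closedBefore (pushNew w b) A' = closedBefore w A + (k - #A) := by
  rw [closedBefore, Fin.sum_univ_castSucc, closedBefore]
  have hl : ∀ i : Fin n, ¬ Fin.last n < i.castSucc := fun i => (Fin.castSucc_lt_last i).not_gt
  have hb : ∀ c, b ≠ b.succAbove c := fun c => (Fin.succAbove_ne b c).symm
  simp only [Fin.sum_univ_succAbove _ b, Fin.forall_fin_succ', Fin.snoc_castSucc,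
    Fin.snoc_last, Fin.castSucc_lt_castSucc_iff, Fin.castSucc_lt_last, lt_irrefl, hl, hA,
    imp_true_iff, true_and, and_true, Function.comp, Fin.succAbove_right_inj, hb, false_imp_iff,
    forall_true_left, and_false, if_false, zero_add]
  rw [add_right_inj, ← card_filter, show k - #A = #Aᶜ by rw [card_compl, Fintype.card_fin]]
  congr 1
  ext c
  simp

theorem openerSum_pushNew : openerSum (pushNew w b) = openerSum w + n := by
  rw [openerSum, Fin.sum_univ_castSucc, openerSum]
  have hl : ∀ i : Fin n, ¬ Fin.last n < i.castSucc := fun i => (Fin.castSucc_lt_last i).not_gt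
  simp [Fin.forall_fin_succ', hl]

end Open

end BlockWord

/-! ### The insertion labels -/

/-- The label of the gap `g` among `N` gaps, some of them special: the special gaps are labelled
from right to left, then the other gaps from left to right. -/
def gapLabel (sp : ℕ → Prop) [DecidablePred sp] (N g : ℕ) : ℕ :=
  (if sp g then 0 else g) + ∑ r ∈ range N, if g < r ∧ sp r then 1 else 0

/-- The labels permute `0, …, N - 1`. A further gap on the right, if special, takes label `0` and
shifts all others by one; if not, it takes label `N` and changes nothing. -/
theorem sum_gapLabel {M : Type*} [AddCommMonoid M] (sp : ℕ → Prop) [DecidablePred sp] (N : ℕ)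
    (φ : ℕ → M) : ∑ g ∈ range N, φ (gapLabel sp N g) = ∑ j ∈ range N, φ j := by
  induction N generalizing φ with
  | zero => simp
  | succ N ih =>
    have hlast : gapLabel sp (N + 1) N = if sp N then 0 else N := by
      rw [gapLabel, sum_eq_zero, add_zero]
      intro r hr
      rw [if_neg]
      rintro ⟨h, -⟩
      exact absurd (mem_range.mp hr) (by omega)
    have hstep : ∀ g ∈ range N, gapLabel sp (N + 1) g
        = gapLabel sp N g + if sp N then 1 else 0 := by
      intro g hg
      rw [gapLabel, gapLabel, sum_range_succ, add_assoc]
      simp [mem_range.mp hg]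
    rw [sum_range_succ, hlast, sum_congr rfl fun g hg => by rw [hstep g hg]]
    by_cases h : sp N
    · simp only [h, if_true]
      rw [ih fun j => φ (j + 1), sum_range_succ']
    · simp only [h, if_false, add_zero]
      rw [ih, sum_range_succ]

theorem gapLabel_lt (sp : ℕ → Prop) [DecidablePred sp] {N g : ℕ} (hg : g < N) :
    gapLabel sp N g < N := by
  by_contra h
  -- Counting the labels that are at least `N` gives zero.
  have h0 := sum_gapLabel sp N fun j => if j < N then 0 else 1
  rw [sum_eq_zero (s := range N) (f := fun j => if j < N then 0 else 1)
    fun j hj => if_pos (mem_range.mp hj), sum_eq_zero_iff] at h0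
  simpa [h] using h0 g (mem_range.mpr hg)

theorem val_succAbove {k : ℕ} (b : Fin (k + 1)) (c : Fin k) :
    (b.succAbove c : ℕ) = if (c : ℕ) < b then (c : ℕ) else c + 1 := by
  rw [Fin.succAbove]
  simp only [Fin.lt_def, Fin.val_castSucc]
  split_ifs <;> simp

/-! ### The block major index when a block is inserted -/

namespace BlockWord

variable {n k : ℕ}

section Open

variable (w : Fin n → Fin k) (A : Finset (Fin k)) (b : Fin (k + 1)) (A' : Finset (Fin (k + 1)))

/-- A gap between blocks, named by the block on its right, is special if it is a descent, if the
block on its right is active, or if it is the last one. -/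
def IsSpecial (g : ℕ) : Prop :=
  ∀ h : g < k, IsDescent w A ⟨g, h⟩ ∨ ⟨g, h⟩ ∈ A

instance : DecidablePred (IsSpecial w A) := fun g =>
  inferInstanceAs (Decidable (∀ h : g < k, IsDescent w A ⟨g, h⟩ ∨ ⟨g, h⟩ ∈ A))

theorem not_isDescent_pushNew_self (hw : Function.Surjective w) :
    ¬ IsDescent (pushNew w b) A' b := by
  rintro ⟨-, l, hl, h⟩
  have hlb : l ≠ b := by rintro rfl; omega
  obtain ⟨c, rfl⟩ := Fin.exists_succAbove_eq hlb
  obtain ⟨i, rfl⟩ := hw c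
  exact (Fin.castSucc_lt_last i).not_gt (h i.castSucc (Fin.last n) (by simp) (by simp))

theorem isDescent_pushNew (hA : ∀ c, b.succAbove c ∈ A' ↔ c ∈ A) (r : Fin k) :
    IsDescent (pushNew w b) A' (b.succAbove r)
      ↔ if (r : ℕ) = b then r ∉ A else IsDescent w A r := by
  have hval := val_succAbove b
  split_ifs with hrb
  · refine ⟨fun h => (hA r).not.mp h.1, fun h => ⟨(hA r).not.mpr h, b, ?_, ?_⟩⟩
    · rw [hval, if_neg (by omega), hrb]
    · simp [Fin.forall_fin_succ', Fin.succAbove_ne]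
  · simp only [IsDescent, hA]
    refine and_congr_right fun _ => ?_
    constructor
    · rintro ⟨l, hlr, h⟩
      have hlb : l ≠ b := by
        rintro rfl
        rw [hval] at hlr
        split_ifs at hlr <;> omega
      obtain ⟨c, rfl⟩ := Fin.exists_succAbove_eq hlb
      refine ⟨c, ?_, fun i j hi hj => ?_⟩
      · rw [hval, hval] at hlr
        split_ifs at hlr <;> omega
      · simpa using h i.castSucc j.castSucc (by simp [hi]) (by simp [hj])
    · rintro ⟨l, hlr, h⟩
      refine ⟨b.succAbove l, ?_, ?_⟩
      · rw [hval, hval]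
        split_ifs <;> omega
      · simpa [Fin.forall_fin_succ', (Fin.succAbove_ne b _).symm] using h

/-- The new block is no descent, and its right neighbour becomes one exactly when closed. Descents
strictly further right move by one, and each active block on the right is counted once. So a special
gap gains the number of special gaps strictly to its right, and any other gap gains `b` more. -/
theorem maj_pushNew (hA : ∀ c, b.succAbove c ∈ A' ↔ c ∈ A) (hw : Function.Surjective w) :
    maj (pushNew w b) A' + #{c ∈ A | b < b.succAbove c}
      = maj w A + gapLabel (IsSpecial w A) (k + 1) b := by
  have hval := val_succAbove b
  have hspec : ∀ c : Fin k, IsSpecial w A c ↔ IsDescent w A c ∨ c ∈ A := fun c =>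
    ⟨fun h => h c.2, fun h _ => h⟩
  have hlast : IsSpecial w A k := fun h => absurd h (lt_irrefl k)
  have hcard : #{c ∈ A | b < b.succAbove c} = ∑ c : Fin k, if c ∈ A ∧ (b : ℕ) ≤ c then 1 else 0 := by
    rw [← card_filter]
    congr 1
    ext c
    simp only [mem_filter, mem_univ, true_and, Fin.lt_def, hval]
    refine and_congr_right fun _ => ?_
    split_ifs <;> omega
  -- The gap `k` is always special and has no block on its right. For `b < k` its unit is moved to
  -- the term `c = b`, as the `+ 1` there.
  have hlab : gapLabel (IsSpecial w A) (k + 1) b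
      = ∑ c : Fin k, ((if (c : ℕ) = b then (if IsSpecial w A c then 0 else (c : ℕ)) + 1 else 0)
          + if (b : ℕ) < c ∧ IsSpecial w A c then 1 else 0) := by
    rw [gapLabel, sum_range_succ, sum_add_distrib,
      ← Fin.sum_univ_eq_sum_range (fun r => if (b : ℕ) < r ∧ IsSpecial w A r then 1 else 0) k]
    have hb := Nat.lt_succ_iff.mp b.2
    rcases hb.lt_or_eq with hbk | hbk
    · rw [Fintype.sum_eq_single (f := fun c : Fin k => if (c : ℕ) = b then _ else 0) ⟨b, hbk⟩
        fun c hc => if_neg fun h => hc (Fin.ext h)]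
      simp only [hbk, hlast, if_true, and_self]
      ring
    · rw [sum_eq_zero (s := univ) (f := fun c : Fin k => if (c : ℕ) = b then _ else 0)]
      · simp [hbk, hlast]
      · intro c _
        exact if_neg (by omega)
  rw [maj, Fin.sum_univ_succAbove _ b, if_neg (not_isDescent_pushNew_self w b A' hw), zero_add,
    hcard, hlab, maj, ← sum_add_distrib, ← sum_add_distrib]
  refine sum_congr rfl fun c _ => ?_
  simp only [isDescent_pushNew w A b A' hA, hspec, hval]
  have hdis : IsDescent w A c → c ∉ A := fun h => h.1
  by_cases h1 : c ∈ A <;> by_cases h2 : IsDescent w A c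
  · exact absurd h1 (hdis h2)
  all_goals
    rcases lt_trichotomy (c : ℕ) b with h | h | h
    · simp [h1, h2, h, h.ne, h.not_ge, h.not_gt]
    · simp [h1, h2, h]
    · simp [h1, h2, h.ne', h.le, h, h.not_gt]

end Open

end BlockWord

/-! ### The generating function of partial ordered partitions -/

section GeneratingFunctions

variable {R : Type*} [CommSemiring R]

theorem pqNat_succ (p q : R) (k : ℕ) : pqNat p q (k + 1) = p * pqNat p q k + q ^ k := by
  rw [pqNat, sum_range_succ, pqNat, mul_sum]
  congr 1
  · refine sum_congr rfl fun j hj => ?_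
    have := mem_range.mp hj
    rw [show k + 1 - 1 - j = (k - 1 - j) + 1 by omega, pow_succ]
    ring
  · simp

theorem sum_pow_card_gt_mul_pow_card_lt {α : Type*} [LinearOrder α] (p q : R) (A : Finset α) :
    ∑ b ∈ A, p ^ #{c ∈ A | b < c} * q ^ #{c ∈ A | c < b} = pqNat p q #A := by
  induction A using Finset.induction_on_max with
  | empty => simp [pqNat]
  | insert a s hs ih =>
    have ha : a ∉ s := fun h => lt_irrefl a (hs a h)
    rw [sum_insert ha, card_insert_of_notMem ha, pqNat_succ, ← ih, add_comm, mul_sum]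
    congr 1
    · refine sum_congr rfl fun b hb => ?_
      rw [filter_insert, if_pos (hs b hb), filter_insert, if_neg (hs b hb).not_gt,
        card_insert_of_notMem (by simp [ha]), pow_succ]
      ring
    · rw [filter_insert, if_neg (lt_irrefl a), filter_insert, if_neg (lt_irrefl a),
        filter_eq_empty_iff.mpr fun c hc => (hs c hc).not_gt, filter_true_of_mem fun c hc => hs c hc]
      simp

/-! ### Transfer rules for the weight -/

namespace BlockWord

variable {n k : ℕ} (p q y z : R)

/-- The weight of a partial ordered partition. -/
def weight (w : Fin n → Fin k) (A : Finset (Fin k)) : R :=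
  p ^ (rsb w A + maj w A) * q ^ (lsb w A + comaj w A) * y ^ closedBefore w A * z ^ openerSum w

theorem weight_push (w : Fin n → Fin k) (A : Finset (Fin k)) (b : Fin k)
    (hw : Function.Surjective w) :
    weight p q y z (push w b) A = weight p q y z w (insert b A) * y ^ (k - #(insert b A)) *
      (p ^ #{c ∈ insert b A | b < c} * q ^ #{c ∈ insert b A | c < b}) := by
  rw [weight, rsb_push w A b hw, lsb_push w A b hw, maj_push w A b hw, comaj_push w A b hw,
    closedBefore_push, openerSum_push w b hw, weight, filter_insert, if_neg (lt_irrefl b),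
    filter_insert, if_neg (lt_irrefl b)]
  simp only [pow_add]
  ring

/-- The exponent of `p` is `maj_pushNew`. That of `q` follows from totals: `rsb + lsb` grows by `#A`
and `maj + comaj` by `k`. -/
theorem weight_pushNew (w : Fin n → Fin k) (A : Finset (Fin k)) (b : Fin (k + 1))
    (A' : Finset (Fin (k + 1))) (hA : ∀ c, b.succAbove c ∈ A' ↔ c ∈ A)
    (hw : Function.Surjective w) :
    weight p q y z (pushNew w b) A' = weight p q y z w A * y ^ (k - #A) * z ^ n * q ^ #A *
      (p ^ gapLabel (IsSpecial w A) (k + 1) b *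
        q ^ (k + 1 - 1 - gapLabel (IsSpecial w A) (k + 1) b)) := by
  have h1 := maj_pushNew w A b A' hA hw
  have h2 := maj_add_comaj w A
  have h3 := maj_add_comaj (pushNew w b) A'
  rw [Fin.sum_univ_castSucc] at h3
  simp only [Fin.val_castSucc, Fin.val_last] at h3
  rw [← h2] at h3
  have h4 : #{c ∈ A | b < b.succAbove c} + #{c ∈ A | b.succAbove c < b} = #A := by
    rw [← card_filter_add_card_filter_not (s := A) (fun c => b < b.succAbove c)]
    congr 2
    ext c
    simp [lt_iff_le_and_ne, Fin.succAbove_ne]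
  have h5 := gapLabel_lt (IsSpecial w A) b.2
  have hp : rsb (pushNew w b) A' + maj (pushNew w b) A'
      = rsb w A + maj w A + gapLabel (IsSpecial w A) (k + 1) b := by
    rw [rsb_pushNew w A b A' hA hw]
    omega
  have hq : lsb (pushNew w b) A' + comaj (pushNew w b) A'
      = lsb w A + comaj w A + #A + (k + 1 - 1 - gapLabel (IsSpecial w A) (k + 1) b) := by
    rw [lsb_pushNew w A b A' hA hw]
    omega
  rw [weight, hp, hq, closedBefore_pushNew w A b A' hA, openerSum_pushNew, weight]
  simp only [pow_add]
  ring

/-- Pairs the two outcomes of a step at the block `b`, which stays active or closes. -/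
theorem sum_finset_eq_sum_mem {α M : Type*} [Fintype α] [DecidableEq α] [AddCommMonoid M] (b : α)
    (g : Finset α → M) :
    ∑ A, g A = ∑ A with b ∈ A, (g A + g (A.erase b)) := by
  rw [sum_add_distrib, ← sum_filter_add_sum_filter_not univ (fun A => b ∈ A) g]
  congr 1
  refine sum_nbij' (insert b) (fun A => A.erase b) ?_ ?_ ?_ ?_ ?_
  · simp
  · simp
  · intro A hA
    exact erase_insert (by simpa using hA)
  · intro A hA
    exact insert_erase (by simpa using hA)
  · intro A hA
    rw [erase_insert (by simpa using hA)]

theorem sum_push (w : Fin n → Fin k) (hw : Function.Surjective w) (f : ℕ → R) :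
    ∑ b, ∑ A, weight p q y z (push w b) A * f #A
      = ∑ A, weight p q y z w A * (y ^ (k - #A) * pqNat p q #A * (f #A + f (#A - 1))) := by
  have h : ∀ b, ∑ A, weight p q y z (push w b) A * f #A = ∑ A with b ∈ A,
      weight p q y z w A * y ^ (k - #A) * (f #A + f (#A - 1)) *
        (p ^ #{c ∈ A | b < c} * q ^ #{c ∈ A | c < b}) := by
    intro b
    rw [sum_finset_eq_sum_mem b]
    refine sum_congr rfl fun A hA => ?_
    have hbA : b ∈ A := by simpa using hA
    rw [weight_push _ _ _ _ _ _ _ hw, weight_push _ _ _ _ _ _ _ hw, insert_eq_of_mem hbA,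
      insert_erase hbA, card_erase_of_mem hbA]
    ring
  simp only [h, sum_filter]
  rw [sum_comm]
  refine sum_congr rfl fun A _ => ?_
  rw [← sum_filter, ← mul_sum, filter_mem_eq_inter, univ_inter, sum_pow_card_gt_mul_pow_card_lt]
  ring

theorem sum_finset_succAbove {M : Type*} [AddCommMonoid M] (b : Fin (k + 1))
    (g : Finset (Fin (k + 1)) → M) :
    ∑ A, g A = ∑ A : Finset (Fin k),
      (g (insert b (A.map b.succAboveEmb)) + g (A.map b.succAboveEmb)) := by
  rw [sum_finset_eq_sum_mem b]
  symm
  have hb : ∀ A : Finset (Fin k), b ∉ A.map b.succAboveEmb := by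
    intro A
    simp [Fin.succAbove_ne]
  refine sum_nbij' (fun A => insert b (A.map b.succAboveEmb))
    (fun A => univ.filter fun c => b.succAbove c ∈ A) ?_ ?_ ?_ ?_ ?_
  · simp
  · simp
  · intro A _
    ext c
    simp [Fin.succAbove_ne]
  · intro A hA
    have hbA : b ∈ A := by simpa using hA
    ext c
    rcases Fin.eq_self_or_eq_succAbove b c with rfl | ⟨c, rfl⟩
    · simp [hbA]
    · simp [Fin.succAbove_ne]
  · intro A _
    rw [erase_insert (hb A)]

theorem sum_pushNew (w : Fin n → Fin k) (hw : Function.Surjective w) (f : ℕ → R) :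
    ∑ b, ∑ A, weight p q y z (pushNew w b) A * f #A
      = ∑ A, weight p q y z w A *
          (y ^ (k - #A) * z ^ n * q ^ #A * pqNat p q (k + 1) * (f (#A + 1) + f #A)) := by
  have h : ∀ b : Fin (k + 1), ∑ A, weight p q y z (pushNew w b) A * f #A
      = ∑ A, weight p q y z w A * (y ^ (k - #A) * z ^ n * q ^ #A) * (f (#A + 1) + f #A) *
        (p ^ gapLabel (IsSpecial w A) (k + 1) b *
        q ^ (k + 1 - 1 - gapLabel (IsSpecial w A) (k + 1) b)) := by
    intro b
    rw [sum_finset_succAbove b]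
    refine sum_congr rfl fun A _ => ?_
    rw [weight_pushNew _ _ _ _ w A b (insert b (A.map b.succAboveEmb)) _ hw,
      weight_pushNew _ _ _ _ w A b (A.map b.succAboveEmb) _ hw, card_insert_of_notMem, card_map]
    · ring
    · simp [Fin.succAbove_ne]
    · simp
    · simp [Fin.succAbove_ne]
  simp only [h]
  rw [sum_comm]
  refine sum_congr rfl fun A _ => ?_
  rw [← mul_sum, Fin.sum_univ_eq_sum_range (fun b => p ^ gapLabel (IsSpecial w A) (k + 1) b *
        q ^ (k + 1 - 1 - gapLabel (IsSpecial w A) (k + 1) b)) (k + 1),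
    sum_gapLabel _ _ fun j => p ^ j * q ^ (k + 1 - 1 - j), ← sum_range_reflect]
  rw [show ∑ j ∈ range (k + 1), p ^ (k + 1 - 1 - j) * q ^ (k + 1 - 1 - (k + 1 - 1 - j))
    = pqNat p q (k + 1) from sum_congr rfl fun j hj => by
      rw [show k + 1 - 1 - (k + 1 - 1 - j) = j by have := mem_range.mp hj; omega]]
  ring

/-- The generating function of the partial ordered partitions of `[n]` into `k` blocks, where the
number of active blocks is weighted by `f`. -/
def partialSum (n k : ℕ) (f : ℕ → R) : R :=
  ∑ w : Fin n → Fin k with Function.Surjective w, ∑ A, weight p q y z w A * f #A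

/-- Without its last letter, a surjective word is still surjective or misses exactly the last value
`b`; in the second case it factors through `b.succAbove`. -/
theorem sum_surjective_succ {M : Type*} [AddCommMonoid M] (g : (Fin (n + 1) → Fin (k + 1)) → M) :
    ∑ w with Function.Surjective w, g w
      = ∑ w : Fin n → Fin (k + 1) with Function.Surjective w, ∑ b, g (push w b)
        + ∑ w : Fin n → Fin k with Function.Surjective w, ∑ b, g (pushNew w b) := by
  have hpush : ∑ w with Function.Surjective w, g w
      = ∑ w : Fin n → Fin (k + 1), ∑ b, if Function.Surjective (push w b) then g (push w b) else 0 := by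
    rw [sum_filter, ← (Fin.snocEquiv fun _ => Fin (k + 1)).sum_comp, Fintype.sum_prod_type,
      sum_comm]
    rfl
  have hsurj : ∀ w : Fin n → Fin (k + 1), Function.Surjective w → ∀ b,
      Function.Surjective (push w b) := by
    intro w hw b c
    obtain ⟨i, rfl⟩ := hw c
    exact ⟨i.castSucc, by simp⟩
  rw [hpush, ← sum_filter_add_sum_filter_not univ fun w : Fin n → Fin (k + 1) =>
    Function.Surjective w]
  congr 1
  · refine sum_congr rfl fun w hw => sum_congr rfl fun b _ => if_pos (hsurj w ?_ b)
    simpa using hw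
  · simp only [← sum_filter (s := (univ : Finset (Fin (k + 1))))]
    rw [sum_sigma', sum_sigma']
    symm
    refine sum_bij (fun x _ => ⟨x.2.succAbove ∘ x.1, x.2⟩) ?_ ?_ ?_ ?_
    · rintro ⟨w, b⟩ hw
      have hw : Function.Surjective w := by simpa using hw
      simp only [mem_sigma, mem_filter, mem_univ, true_and]
      refine ⟨fun h => ?_, fun c => ?_⟩
      · obtain ⟨i, hi⟩ := h b
        exact Fin.succAbove_ne b _ hi
      · rcases Fin.eq_self_or_eq_succAbove b c with rfl | ⟨c, rfl⟩
        · exact ⟨Fin.last n, by simp⟩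
        · obtain ⟨i, rfl⟩ := hw c
          exact ⟨i.castSucc, by simp⟩
    · rintro ⟨w, b⟩ _ ⟨w', b'⟩ _ h
      obtain ⟨h1, h2⟩ := Sigma.mk.inj h
      obtain rfl := eq_of_heq h2
      obtain rfl : w = w' := (Fin.succAbove_right_injective).comp_left h1
      rfl
    · rintro ⟨w, b⟩ h
      simp only [mem_sigma, mem_filter, mem_univ, true_and] at h
      have hb : ∀ i, w i ≠ b := by
        rintro i rfl
        refine h.1 fun c => ?_
        obtain ⟨j, hj⟩ := h.2 c
        induction j using Fin.lastCases with
        | last => exact ⟨i, by simpa using hj⟩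
        | cast j => exact ⟨j, by simpa using hj⟩
      choose v hv using fun i => Fin.exists_succAbove_eq (hb i)
      have hvw : b.succAbove ∘ v = w := funext hv
      refine ⟨⟨v, b⟩, ?_, by rw [hvw]⟩
      simp only [mem_sigma, mem_filter, mem_univ, true_and, and_true]
      intro c
      obtain ⟨j, hj⟩ := h.2 (b.succAbove c)
      induction j using Fin.lastCases with
      | last => simp at hj
      | cast j =>
        refine ⟨j, Fin.succAbove_right_injective (p := b) ?_⟩
        rw [hv]
        simpa using hj
    · rintro ⟨w, b⟩ _
      rfl

theorem partialSum_succ_succ (f : ℕ → R) :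
    partialSum p q y z (n + 1) (k + 1) f
      = partialSum p q y z n (k + 1)
          (fun h => y ^ (k + 1 - h) * pqNat p q h * (f h + f (h - 1)))
        + partialSum p q y z n k
          (fun h => y ^ (k - h) * z ^ n * q ^ h * pqNat p q (k + 1) * (f (h + 1) + f h)) := by
  rw [partialSum, sum_surjective_succ]
  congr 1
  · exact sum_congr rfl fun w hw => sum_push p q y z w (by simpa using hw) f
  · exact sum_congr rfl fun w hw => sum_pushNew p q y z w (by simpa using hw) f

theorem partialSum_succ_zero (f : ℕ → R) : partialSum p q y z (n + 1) 0 f = 0 := by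
  rw [partialSum, univ_eq_empty_iff.mpr ⟨fun w => (w 0).elim0⟩]
  rfl

theorem partialSum_zero_succ (f : ℕ → R) : partialSum p q y z 0 (k + 1) f = 0 := by
  rw [partialSum, filter_eq_empty_iff.mpr, sum_empty]
  intro w _ hw
  obtain ⟨i, -⟩ := hw 0
  exact i.elim0

theorem partialSum_zero_zero (f : ℕ → R) : partialSum p q y z 0 0 f = f 0 := by
  rw [partialSum, filter_true_of_mem fun w _ c => c.elim0, Fintype.sum_unique, Fintype.sum_unique]
  simp [weight, rsb, lsb, maj, comaj, closedBefore, openerSum, Subsingleton.elim default ∅]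

theorem partialSum_congr {f g : ℕ → R} (h : ∀ a ≤ k, f a = g a) :
    partialSum p q y z n k f = partialSum p q y z n k g := by
  refine sum_congr rfl fun w _ => sum_congr rfl fun A _ => ?_
  rw [h _ ((card_le_univ A).trans_eq (Fintype.card_fin k))]

end BlockWord

/-! ### Stirling numbers and binomial coefficients -/

theorem pqNat_zero (p q : R) : pqNat p q 0 = 0 := by simp [pqNat]

theorem pqNat_one (p q : R) : pqNat p q 1 = 1 := by simp [pqNat]

theorem pqNat_add (p q : R) (a b : ℕ) :
    pqNat p q (a + b) = p ^ a * pqNat p q b + q ^ b * pqNat p q a := by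
  induction a with
  | zero => simp [pqNat_zero]
  | succ a ih =>
    rw [Nat.succ_add, pqNat_succ, ih, pqNat_succ]
    ring

theorem pqFactorial_zero (p q : R) : pqFactorial p q 0 = 1 := by simp [pqFactorial]

theorem pqFactorial_succ (p q : R) (k : ℕ) :
    pqFactorial p q (k + 1) = pqFactorial p q k * pqNat p q (k + 1) :=
  prod_Icc_succ_top (by omega) _

/-- The rising product `[u+1]_{p,q} [u+2]_{p,q} ⋯ [u+h]_{p,q}`. -/
def pqAscFactorial (p q : R) (u h : ℕ) : R := ∏ j ∈ range h, pqNat p q (u + 1 + j)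

theorem pqAscFactorial_succ (p q : R) (u h : ℕ) :
    pqAscFactorial p q u (h + 1) = pqAscFactorial p q u h * pqNat p q (u + h + 1) := by
  rw [pqAscFactorial, prod_range_succ, pqAscFactorial, Nat.add_right_comm]

theorem pqAscFactorial_succ' (p q : R) (u h : ℕ) :
    pqAscFactorial p q u (h + 1) = pqNat p q (u + 1) * pqAscFactorial p q (u + 1) h := by
  rw [pqAscFactorial, prod_range_succ', pqAscFactorial, mul_comm]
  congr 1
  exact prod_congr rfl fun j _ => by rw [show u + 1 + (j + 1) = u + 1 + 1 + j by omega]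

theorem pqAscFactorial_zero_left (p q : R) (h : ℕ) :
    pqAscFactorial p q 0 h = pqFactorial p q h := by
  induction h with
  | zero => simp [pqAscFactorial, pqFactorial]
  | succ h ih => rw [pqAscFactorial_succ, pqFactorial_succ, ih, zero_add]

/-- The reduced `p,q`-Stirling numbers, `S_{p,q}(n,k) / p^{k(k-1)/2}`. -/
def redStirling (p q : R) : ℕ → ℕ → R
  | 0, 0 => 1
  | 0, _ + 1 => 0
  | _ + 1, 0 => 0
  | n + 1, k + 1 => redStirling p q n k + pqNat p q (k + 1) * redStirling p q n (k + 1)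

theorem redStirling_succ_succ (p q : R) (n k : ℕ) : redStirling p q (n + 1) (k + 1)
    = redStirling p q n k + pqNat p q (k + 1) * redStirling p q n (k + 1) := rfl

theorem redStirling_eq_zero (p q : R) {n k : ℕ} (h : n < k) : redStirling p q n k = 0 := by
  induction n generalizing k with
  | zero =>
    obtain ⟨k, rfl⟩ := Nat.exists_eq_succ_of_ne_zero h.ne'
    rfl
  | succ n ih =>
    obtain ⟨k, rfl⟩ := Nat.exists_eq_succ_of_ne_zero (Nat.ne_zero_of_lt h)
    rw [redStirling, ih (by omega), ih (by omega)]
    simp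

theorem pqStirling_eq (p q : R) (n k : ℕ) :
    pqStirling p q n k = p ^ k.choose 2 * redStirling p q n k := by
  induction n generalizing k with
  | zero => cases k <;> simp [pqStirling, redStirling]
  | succ n ih =>
    cases k with
    | zero => simp [pqStirling, redStirling]
    | succ k =>
      rw [pqStirling]
      split_ifs with h
      · rw [ih, ih, redStirling, Nat.choose_succ_succ' k 1, Nat.choose_one_right, pow_add]
        ring
      · rw [redStirling_eq_zero p q (by omega), mul_zero]

theorem pqNat_swap (p q : R) (k : ℕ) : pqNat p q k = pqNat q p k := by
  rw [pqNat, ← sum_range_reflect]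
  refine sum_congr rfl fun j hj => ?_
  rw [show k - 1 - (k - 1 - j) = j by have := mem_range.mp hj; omega, mul_comm]

theorem redStirling_swap (p q : R) (n k : ℕ) : redStirling p q n k = redStirling q p n k := by
  induction n generalizing k with
  | zero => cases k <;> rfl
  | succ n ih =>
    cases k with
    | zero => rfl
    | succ k => rw [redStirling, redStirling, ih, ih, pqNat_swap]

/-- The homogeneous `p,q`-binomial coefficient of `c + h` over `c`, times
`p^{c(c-1)/2} q^{h(h-1)/2}`. -/
def pqBinom (p q : R) : ℕ → ℕ → R
  | 0, 0 => 1
  | c + 1, 0 => p ^ c * pqBinom p q c 0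
  | 0, h + 1 => q ^ h * pqBinom p q 0 h
  | c + 1, h + 1 => p ^ (c + 1) * q ^ h * pqBinom p q (c + 1) h
      + p ^ c * q ^ (h + 1) * pqBinom p q c (h + 1)

theorem pqBinom_zero_right (p q : R) (c : ℕ) : pqBinom p q c 0 = p ^ c.choose 2 := by
  induction c with
  | zero => simp [pqBinom]
  | succ c ih => rw [pqBinom, ih, Nat.choose_succ_succ' c 1, Nat.choose_one_right, pow_add]

theorem pqBinom_succ_succ (p q : R) (c h : ℕ) : pqBinom p q (c + 1) (h + 1)
    = p ^ (c + 1) * q ^ h * pqBinom p q (c + 1) h + p ^ c * q ^ (h + 1) * pqBinom p q c (h + 1) := by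
  rw [pqBinom]

theorem pqNat_add_add_two (p q : R) (c h : ℕ) : pqNat p q (c + h + 1 + 1)
    = p ^ (c + 1) * pqNat p q (h + 1) + q ^ (h + 1) * pqNat p q (c + 1) := by
  rw [← pqNat_add]
  congr 1
  ring

/-- In a semiring the quotient formula for binomials is only available cross-multiplied. The two
absorption rules are proved in alternation: the right rule at `c` gives the left rule at `c`, and
both give the right rule at `c + 1`. -/
theorem pqNat_mul_pqBinom_succ_left_of_right (p q : R) (c : ℕ)
    (hr : ∀ h, pqNat p q (h + 1) * pqBinom p q c (h + 1)
      = q ^ h * pqNat p q (c + h + 1) * pqBinom p q c h) (h : ℕ) :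
    pqNat p q (c + 1) * pqBinom p q (c + 1) h
      = p ^ c * pqNat p q (c + h + 1) * pqBinom p q c h := by
  induction h with
  | zero =>
    have : pqBinom p q (c + 1) 0 = p ^ c * pqBinom p q c 0 := by rw [pqBinom]
    rw [this]
    ring
  | succ h ih =>
    calc pqNat p q (c + 1) * pqBinom p q (c + 1) (h + 1)
        = p ^ (c + 1) * q ^ h * (pqNat p q (c + 1) * pqBinom p q (c + 1) h)
          + p ^ c * q ^ (h + 1) * pqNat p q (c + 1) * pqBinom p q c (h + 1) := by
          rw [pqBinom_succ_succ]
          ring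
      _ = p ^ (c + 1) * p ^ c * (q ^ h * pqNat p q (c + h + 1) * pqBinom p q c h)
          + p ^ c * q ^ (h + 1) * pqNat p q (c + 1) * pqBinom p q c (h + 1) := by
          rw [ih]
          ring
      _ = p ^ c * pqNat p q (c + h + 1 + 1) * pqBinom p q c (h + 1) := by
          rw [← hr, pqNat_add_add_two]
          ring

theorem pqNat_mul_pqBinom_succ_right (p q : R) (c h : ℕ) :
    pqNat p q (h + 1) * pqBinom p q c (h + 1)
      = q ^ h * pqNat p q (c + h + 1) * pqBinom p q c h := by
  induction c generalizing h with
  | zero =>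
    rw [pqBinom, zero_add]
    ring
  | succ c ih =>
    calc pqNat p q (h + 1) * pqBinom p q (c + 1) (h + 1)
        = p ^ (c + 1) * q ^ h * pqNat p q (h + 1) * pqBinom p q (c + 1) h
          + p ^ c * q ^ (h + 1) * (pqNat p q (h + 1) * pqBinom p q c (h + 1)) := by
          rw [pqBinom_succ_succ]
          ring
      _ = p ^ (c + 1) * q ^ h * pqNat p q (h + 1) * pqBinom p q (c + 1) h
          + q ^ (h + 1) * q ^ h * (p ^ c * pqNat p q (c + h + 1) * pqBinom p q c h) := by
          rw [ih]
          ring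
      _ = q ^ h * pqNat p q (c + 1 + h + 1) * pqBinom p q (c + 1) h := by
          rw [← pqNat_mul_pqBinom_succ_left_of_right p q c ih, show c + 1 + h + 1 = c + h + 1 + 1 by
            ring, pqNat_add_add_two]
          ring

theorem pqNat_mul_pqBinom_succ_left (p q : R) (c h : ℕ) :
    pqNat p q (c + 1) * pqBinom p q (c + 1) h
      = p ^ c * pqNat p q (c + h + 1) * pqBinom p q c h :=
  pqNat_mul_pqBinom_succ_left_of_right p q c (pqNat_mul_pqBinom_succ_right p q c) h

/-- The sequence `0, f 0, f 1, …`. -/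
def shiftSeq {M : Type*} [Zero M] (f : ℕ → M) : ℕ → M
  | 0 => 0
  | n + 1 => f n

@[simp] theorem shiftSeq_zero {M : Type*} [Zero M] (f : ℕ → M) : shiftSeq f 0 = 0 := rfl

@[simp] theorem shiftSeq_succ {M : Type*} [Zero M] (f : ℕ → M) (n : ℕ) :
    shiftSeq f (n + 1) = f n := rfl

/-- Pascal's rule in dual form: the new block is active (`h + 1`) or already closed (`h`). -/
theorem sum_antidiagonal_pqBinom_succ (p q : R) (k : ℕ) (f : ℕ → R) :
    ∑ x ∈ antidiagonal (k + 1), pqBinom p q x.1 x.2 * f x.2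
      = ∑ x ∈ antidiagonal k, pqBinom p q x.1 x.2 * (p ^ x.1 * q ^ x.2 * (f (x.2 + 1) + f x.2)) := by
  -- On the two borders Pascal's rule has a single term; the leading `0` of `shiftSeq` supplies the
  -- other.
  have h : ∀ x : ℕ × ℕ, x ∈ antidiagonal (k + 1) → pqBinom p q x.1 x.2 * f x.2
      = shiftSeq (fun h => pqBinom p q x.1 h * (p ^ x.1 * q ^ h) * f (h + 1)) x.2
        + shiftSeq (fun c => pqBinom p q c x.2 * (p ^ c * q ^ x.2) * f x.2) x.1 := by
    rintro ⟨c, h⟩ hx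
    rcases c with - | c <;> rcases h with - | h
    · simp at hx
    · simp [pqBinom]
      ring
    · simp [pqBinom]
      ring
    · simp [pqBinom]
      ring
  rw [sum_congr rfl h, sum_add_distrib, Nat.sum_antidiagonal_succ', Nat.sum_antidiagonal_succ]
  simp only [shiftSeq_zero, shiftSeq_succ, zero_add, ← sum_add_distrib]
  exact sum_congr rfl fun x _ => by ring

/-- By the absorption rules, the terms in `f (h - 1)` reindex to `q^h [c] f h`; then `p^c [h] + q^h
[c] = [c + h]`. -/
theorem sum_antidiagonal_pqBinom_mul (p q : R) (m : ℕ) (f : ℕ → R) :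
    ∑ x ∈ antidiagonal m, pqBinom p q x.1 x.2 * (p ^ x.1 * pqNat p q x.2 * (f x.2 + f (x.2 - 1)))
      = pqNat p q m * ∑ x ∈ antidiagonal m, pqBinom p q x.1 x.2 * f x.2 := by
  have hshift : ∑ x ∈ antidiagonal m, pqBinom p q x.1 x.2 * (p ^ x.1 * pqNat p q x.2 * f (x.2 - 1))
      = ∑ x ∈ antidiagonal m, pqBinom p q x.1 x.2 * (q ^ x.2 * pqNat p q x.1 * f x.2) := by
    cases m with
    | zero => simp [pqNat_zero]
    | succ m =>
      rw [Nat.sum_antidiagonal_succ', Nat.sum_antidiagonal_succ]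
      simp only [pqNat_zero, mul_zero, zero_mul, zero_add, Nat.add_sub_cancel]
      refine sum_congr rfl fun x _ => ?_
      calc _ = p ^ x.1 * (pqNat p q (x.2 + 1) * pqBinom p q x.1 (x.2 + 1)) * f x.2 := by ring
        _ = q ^ x.2 * (pqNat p q (x.1 + 1) * pqBinom p q (x.1 + 1) x.2) * f x.2 := by
          rw [pqNat_mul_pqBinom_succ_right, pqNat_mul_pqBinom_succ_left]
          ring
        _ = _ := by ring
  simp only [mul_add, sum_add_distrib]
  rw [hshift, ← sum_add_distrib, mul_sum]
  refine sum_congr rfl fun x hx => ?_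
  rw [← mem_antidiagonal.mp hx, pqNat_add]
  ring

/-! ### Evaluation of the generating functions -/

namespace BlockWord

variable (p q y z : R)

theorem partialSum_closed (n k : ℕ) (f : ℕ → R) :
    partialSum p q p 1 n k f = pqFactorial p q k * redStirling p q n k *
      ∑ x ∈ antidiagonal k, pqBinom p q x.1 x.2 * f x.2 := by
  induction n generalizing k f with
  | zero =>
    cases k with
    | zero => simp [partialSum_zero_zero, pqFactorial_zero, redStirling, pqBinom]
    | succ k => simp [partialSum_zero_succ, redStirling]
  | succ n ih =>
    cases k with
    | zero => simp [partialSum_succ_zero, redStirling]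
    | succ k =>
      have h1 : ∑ x ∈ antidiagonal (k + 1), pqBinom p q x.1 x.2 *
          (p ^ (k + 1 - x.2) * pqNat p q x.2 * (f x.2 + f (x.2 - 1)))
          = pqNat p q (k + 1) * ∑ x ∈ antidiagonal (k + 1), pqBinom p q x.1 x.2 * f x.2 := by
        rw [← sum_antidiagonal_pqBinom_mul]
        refine sum_congr rfl fun x hx => ?_
        rw [← mem_antidiagonal.mp hx, Nat.add_sub_cancel]
      have h2 : ∑ x ∈ antidiagonal k, pqBinom p q x.1 x.2 *
          (p ^ (k - x.2) * 1 ^ n * q ^ x.2 * pqNat p q (k + 1) * (f (x.2 + 1) + f x.2))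
          = pqNat p q (k + 1) * ∑ x ∈ antidiagonal (k + 1), pqBinom p q x.1 x.2 * f x.2 := by
        rw [sum_antidiagonal_pqBinom_succ, mul_sum]
        refine sum_congr rfl fun x hx => ?_
        rw [← mem_antidiagonal.mp hx, Nat.add_sub_cancel]
        ring
      rw [partialSum_succ_succ, ih, ih, h1, h2, pqFactorial_succ, redStirling_succ_succ]
      ring

theorem partialSum_MAK (n k : ℕ) :
    partialSum p q p 1 n k (fun h => if h = 0 then 1 else 0)
      = pqFactorial p q k * pqStirling p q n k := by
  rw [partialSum_closed, pqStirling_eq, sum_eq_single (k, 0)]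
  · rw [if_pos rfl, pqBinom_zero_right]
    ring
  · rintro ⟨c, h⟩ hx hne
    rw [if_neg, mul_zero]
    rintro rfl
    exact hne (by simpa using hx)
  · simp

theorem partialSum_add (n k : ℕ) (f g : ℕ → R) :
    partialSum p q y z n k (fun h => f h + g h)
      = partialSum p q y z n k f + partialSum p q y z n k g := by
  simp only [partialSum, ← sum_add_distrib, mul_add]

theorem partialSum_zero_fun (n k : ℕ) : partialSum p q y z n k (fun _ => 0) = 0 := by
  simp [partialSum]

/-- The generating function of the ways to complete a partial ordered partition with `h` active
blocks by `N` letters, `u` of which open a block. -/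
def completion (N u h : ℕ) : R :=
  redStirling p q N (u + h) * p ^ u.choose 2 * pqAscFactorial p q u h

theorem completion_succ_zero_left (N h : ℕ) :
    completion p q (N + 1) 0 h
      = pqNat p q h * (completion p q N 0 h + completion p q N 0 (h - 1)) := by
  cases h with
  | zero => simp [completion, redStirling, pqNat_zero]
  | succ h =>
    simp only [completion, pqAscFactorial_succ, zero_add, redStirling_succ_succ,
      Nat.add_sub_cancel]
    ring

/-- The next letter joins an active block or opens one; every opener still to come gains a smaller
letter, whence `p^(u+1)` or `p^u`. For `h > 0` the algebra rests on `[u+1+h] = p^(u+1) [h] + q^h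
[u+1]`. -/
theorem completion_succ_succ_left (N u h : ℕ) :
    completion p q (N + 1) (u + 1) h
      = p ^ (u + 1) * pqNat p q h * (completion p q N (u + 1) h + completion p q N (u + 1) (h - 1))
        + p ^ u * q ^ h * (completion p q N u (h + 1) + completion p q N u h) := by
  have hc : (u + 1).choose 2 = u + u.choose 2 := by
    rw [Nat.choose_succ_succ' u 1, Nat.choose_one_right]
  cases h with
  | zero =>
    simp only [completion, pqNat_zero, hc, add_zero, redStirling_succ_succ, pow_add,
      pqAscFactorial_succ, zero_add]
    simp [pqAscFactorial]
    ring
  | succ h =>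
    have h1 : pqNat p q (u + 1 + h + 1)
        = p ^ (u + 1) * pqNat p q (h + 1) + q ^ (h + 1) * pqNat p q (u + 1) := by
      rw [← pqNat_add]
      congr 1
    simp only [completion, hc, Nat.add_sub_cancel]
    rw [show u + 1 + (h + 1) = u + (h + 1) + 1 by ring, redStirling_succ_succ,
      show u + (h + 1 + 1) = u + (h + 1) + 1 by ring, show u + 1 + h = u + (h + 1) by ring,
      pqAscFactorial_succ' p q u (h + 1), pqAscFactorial_succ' p q u h, pqAscFactorial_succ,
      show u + (h + 1) + 1 = u + 1 + h + 1 by ring, h1, pow_add p u]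
    ring

/-- Letter number `i + 1` is moved across the cut. In `x = (m, u)`, `m` blocks open before the cut
and `u` after it: `[m+1]⋯[m+u]` accounts for the gaps these `u` receive, and `p^(i*u)` for the `i`
first letters lying below each of their openers. -/
theorem sum_partialSum_completion_succ (i N K : ℕ) :
    ∑ x ∈ antidiagonal K, partialSum p q 1 p (i + 1) x.1
        (fun h => pqAscFactorial p q x.1 x.2 * p ^ ((i + 1) * x.2) * completion p q N x.2 h)
      = ∑ x ∈ antidiagonal K, partialSum p q 1 p i x.1
        (fun h => pqAscFactorial p q x.1 x.2 * p ^ (i * x.2) * completion p q (N + 1) x.2 h) := by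
  have hsplit : ∀ x : ℕ × ℕ, partialSum p q 1 p i x.1
        (fun h => pqAscFactorial p q x.1 x.2 * p ^ (i * x.2) * completion p q (N + 1) x.2 h)
      = partialSum p q 1 p i x.1 (fun h => pqNat p q h * (pqAscFactorial p q x.1 x.2 *
          p ^ ((i + 1) * x.2) * (completion p q N x.2 h + completion p q N x.2 (h - 1))))
        + shiftSeq (fun u => partialSum p q 1 p i x.1 (fun h => pqAscFactorial p q x.1 (u + 1)
          * p ^ (i * (u + 1) + u) * q ^ h * (completion p q N u (h + 1) + completion p q N u h))) x.2 := by
    rintro ⟨m, u⟩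
    cases u with
    | zero =>
      simp only [shiftSeq_zero, add_zero]
      refine partialSum_congr _ _ _ _ fun h _ => ?_
      rw [completion_succ_zero_left]
      ring
    | succ u =>
      simp only [shiftSeq_succ]
      rw [← partialSum_add]
      refine partialSum_congr _ _ _ _ fun h _ => ?_
      rw [completion_succ_succ_left]
      ring
  rw [sum_congr rfl fun x _ => hsplit x, sum_add_distrib]
  cases K with
  | zero =>
    simp only [Nat.antidiagonal_zero, shiftSeq_zero, sum_singleton, partialSum_succ_zero, add_zero]
    rw [partialSum_congr _ _ _ _ (g := fun _ => 0), partialSum_zero_fun]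
    intro h hh
    rw [Nat.le_zero.mp hh, pqNat_zero, zero_mul]
  | succ K =>
    rw [Nat.sum_antidiagonal_succ, Nat.sum_antidiagonal_succ, Nat.sum_antidiagonal_succ']
    -- Without blocks there is no active one to join: `h = 0` and `[0] = 0`.
    have h0 : partialSum p q 1 p i 0 (fun h => pqNat p q h * (pqAscFactorial p q 0 (K + 1) *
          p ^ ((i + 1) * (K + 1)) *
          (completion p q N (K + 1) h + completion p q N (K + 1) (h - 1)))) = 0 := by
      rw [partialSum_congr _ _ _ _ (g := fun _ => 0), partialSum_zero_fun]
      intro h hh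
      rw [Nat.le_zero.mp hh, pqNat_zero, zero_mul]
    simp only [h0, partialSum_succ_zero, shiftSeq_zero, shiftSeq_succ, zero_add, ← sum_add_distrib]
    refine sum_congr rfl fun x _ => ?_
    rw [partialSum_succ_succ]
    congr 1
    · refine partialSum_congr _ _ _ _ fun h _ => ?_
      rw [one_pow]
      ring
    · refine partialSum_congr _ _ _ _ fun h _ => ?_
      rw [one_pow, pqAscFactorial_succ']
      ring

theorem partialSum_MAK' (n k : ℕ) :
    partialSum p q 1 p n k (fun h => if h = 0 then 1 else 0)
      = pqFactorial p q k * pqStirling p q n k := by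
  have hconst : ∀ i N, i + N = n → ∑ x ∈ antidiagonal k, partialSum p q 1 p i x.1
        (fun h => pqAscFactorial p q x.1 x.2 * p ^ (i * x.2) * completion p q N x.2 h)
      = ∑ x ∈ antidiagonal k, partialSum p q 1 p 0 x.1
        (fun h => pqAscFactorial p q x.1 x.2 * p ^ (0 * x.2) * completion p q n x.2 h) := by
    intro i
    induction i with
    | zero =>
      rintro N hN
      rw [show N = n by omega]
    | succ i ih =>
      intro N hN
      rw [sum_partialSum_completion_succ, ih (N + 1) (by omega)]
  have hn := hconst n 0 rfl
  -- At the cut `i = n` no letter is left to open a block, so `u = 0`; at the cut `i = 0` no block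
  -- is open yet, so `m = 0`.
  rw [sum_eq_single (k, 0), sum_eq_single (0, k)] at hn
  · rw [partialSum_zero_zero] at hn
    rw [pqStirling_eq, ← pqAscFactorial_zero_left]
    have hf : ∀ h ≤ k, (if h = 0 then 1 else 0 : R)
        = pqAscFactorial p q k 0 * p ^ (n * 0) * completion p q 0 0 h := by
      intro h _
      cases h <;> simp [pqAscFactorial, completion, redStirling]
    rw [partialSum_congr _ _ _ _ hf, hn]
    simp [completion, pqAscFactorial]
    ring
  · rintro ⟨m, u⟩ hx hne
    cases m with
    | zero => exact absurd (by simpa using hx) hne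
    | succ m => exact partialSum_zero_succ _ _ _ _ _
  · simp
  · rintro ⟨m, u⟩ hx hne
    cases u with
    | zero => exact absurd (by simpa using hx) hne
    | succ u =>
      rw [partialSum_congr _ _ _ _ (g := fun _ => 0), partialSum_zero_fun]
      intro h _
      rw [completion, redStirling_eq_zero p q (by omega)]
      ring
  · simp

end BlockWord

end GeneratingFunctions

/-! ### Ordered partitions as surjective words -/

namespace OrdPartition

variable {n k : ℕ} (π : OrdPartition n k)

theorem mem_block_iff (i : Fin n) (b : Fin k) : i ∈ π.block b ↔ π.w i = b := by
  have hi : i ∈ π.block (π.w i) :=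
    Finset.choose_property (fun b => i ∈ π.block b) univ (π.existsUnique_mem_block i)
  constructor
  · intro h
    by_contra hne
    exact Finset.disjoint_left.mp (π.2.2.1 _ _ hne) hi h
  · rintro rfl
    exact hi

theorem w_opener (b : Fin k) : π.w (π.opener b) = b :=
  (π.mem_block_iff _ _).mp (min'_mem _ _)

theorem w_closer (b : Fin k) : π.w (π.closer b) = b :=
  (π.mem_block_iff _ _).mp (max'_mem _ _)

theorem opener_le (i : Fin n) : π.opener (π.w i) ≤ i :=
  min'_le _ _ ((π.mem_block_iff _ _).mpr rfl)

theorem le_closer (i : Fin n) : i ≤ π.closer (π.w i) :=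
  le_max' _ _ ((π.mem_block_iff _ _).mpr rfl)

theorem opener_le_closer (b : Fin k) : π.opener b ≤ π.closer b := by
  simpa [w_opener] using π.le_closer (π.opener b)

theorem w_surjective : Function.Surjective π.w := fun b => ⟨_, π.w_opener b⟩

theorem opener_injective : Function.Injective π.opener :=
  Function.LeftInverse.injective π.w_opener

theorem closer_injective : Function.Injective π.closer :=
  Function.LeftInverse.injective π.w_closer

theorem w_injective : Function.Injective (w : OrdPartition n k → Fin n → Fin k) := by
  intro π ρ h
  refine Subtype.ext (funext fun b => Finset.ext fun i => ?_)
  exact (π.mem_block_iff i b).trans ((by rw [h] : π.w i = b ↔ ρ.w i = b).trans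
    (ρ.mem_block_iff i b).symm)

theorem exists_w_eq (v : Fin n → Fin k) (hv : Function.Surjective v) :
    ∃ π : OrdPartition n k, π.w = v := by
  let π : OrdPartition n k := ⟨fun b => univ.filter fun i => v i = b, by
    refine ⟨fun b => ?_, fun b c hbc => ?_, ?_⟩
    · obtain ⟨i, hi⟩ := hv b
      exact ⟨i, by simpa using hi⟩
    · rw [Finset.disjoint_left]
      intro i hb hc
      simp only [mem_filter, mem_univ, true_and] at hb hc
      exact hbc (hb.symm.trans hc)
    · ext i
      simp⟩
  refine ⟨π, funext fun i => (π.mem_block_iff i (v i)).mp ?_⟩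
  exact mem_filter.mpr ⟨mem_univ i, rfl⟩

theorem sum_eq_sum_surjective {M : Type*} [AddCommMonoid M] (g : (Fin n → Fin k) → M) :
    ∑ π : OrdPartition n k, g π.w = ∑ v : Fin n → Fin k with Function.Surjective v, g v := by
  refine sum_bij (fun π _ => π.w) (fun π _ => by simpa using π.w_surjective)
    (fun π _ ρ _ h => w_injective h) (fun v hv => ?_) (fun _ _ => rfl)
  obtain ⟨π, rfl⟩ := exists_w_eq v (by simpa using hv)
  exact ⟨π, mem_univ _, rfl⟩

theorem opener_lt_iff (i : Fin n) (b : Fin k) : π.opener b < i ↔ ∃ j, j < i ∧ π.w j = b := by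
  refine ⟨fun h => ⟨_, h, π.w_opener b⟩, ?_⟩
  rintro ⟨j, hj, rfl⟩
  exact (π.opener_le j).trans_lt hj

theorem lt_closer_iff (i : Fin n) (b : Fin k) : i < π.closer b ↔ ∃ j, i < j ∧ π.w j = b := by
  refine ⟨fun h => ⟨_, h, π.w_closer b⟩, ?_⟩
  rintro ⟨j, hj, rfl⟩
  exact hj.trans_le (π.le_closer j)

theorem closer_lt_iff (i : Fin n) (b : Fin k) : π.closer b < i ↔ ∀ j, π.w j = b → j < i := by
  refine ⟨?_, fun h => h _ (π.w_closer b)⟩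
  rintro h j rfl
  exact (π.le_closer j).trans_lt h

theorem spans_iff (i : Fin n) (b : Fin k) :
    BlockWord.Spans π.w ∅ i b ↔ π.opener b < i ∧ i < π.closer b := by
  simp [BlockWord.Spans, opener_lt_iff, lt_closer_iff]

theorem rosAt_eq (i : Fin n) :
    π.rosAt i = ∑ b, if π.opener b < i ∧ π.w i < b then 1 else 0 := by
  rw [rosAt, openers, filter_image, card_image_of_injective _ π.opener_injective, card_filter]
  simp only [w_opener]

theorem lobAt_eq (i : Fin n) :
    π.lobAt i = ∑ b, if i < π.opener b ∧ b < π.w i then 1 else 0 := by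
  rw [lobAt, openers, filter_image, card_image_of_injective _ π.opener_injective, card_filter]
  simp only [w_opener]

theorem lcsAt_eq (i : Fin n) :
    π.lcsAt i = ∑ b, if π.closer b < i ∧ b < π.w i then 1 else 0 := by
  rw [lcsAt, closers, filter_image, card_image_of_injective _ π.closer_injective, card_filter]
  simp only [w_closer]

theorem rcbAt_eq (i : Fin n) :
    π.rcbAt i = ∑ b, if i < π.closer b ∧ π.w i < b then 1 else 0 := by
  rw [rcbAt, closers, filter_image, card_image_of_injective _ π.closer_injective, card_filter]
  simp only [w_closer]

theorem lsb_eq : π.lsb = BlockWord.lsb π.w ∅ := by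
  simp only [lsb, lsbAt, BlockWord.lsb, card_filter, spans_iff]

/-- Holds for each letter `i` and block `b`. On the right of `i`, a block already opened either
spans `i` or is closed; on the left, both sides count the closed blocks; the block of `i` counts on
neither side. -/
theorem MAK_eq : π.MAK = BlockWord.rsb π.w ∅ + BlockWord.closedBefore π.w ∅ := by
  rw [MAK, ros, lcs, BlockWord.rsb, BlockWord.closedBefore, ← sum_add_distrib, ← sum_add_distrib]
  refine sum_congr rfl fun i _ => ?_
  rw [rosAt_eq, lcsAt_eq, ← sum_add_distrib, ← sum_add_distrib]
  refine sum_congr rfl fun b _ => ?_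
  simp only [spans_iff, ← closer_lt_iff, notMem_empty, not_false_iff, true_and]
  have h1 := π.opener_le_closer b
  have h2 : b = π.w i → i ≤ π.closer b := by
    rintro rfl
    exact π.le_closer i
  have h3 : b ≠ π.w i → π.closer b ≠ i := by
    rintro h rfl
    exact h (π.w_closer b).symm
  grind

theorem openerSum_eq : BlockWord.openerSum π.w = ∑ b, (π.opener b : ℕ) := by
  rw [BlockWord.openerSum, ← sum_filter, ← sum_image (s := univ) (g := π.opener)
    (f := fun i : Fin n => (i : ℕ)) fun a _ b _ h => π.opener_injective h]
  refine sum_congr ?_ fun _ _ => rfl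
  ext i
  simp only [mem_filter, mem_univ, true_and, mem_image]
  constructor
  · intro h
    refine ⟨π.w i, (π.opener_le i).antisymm (not_lt.mp fun hlt => ?_)⟩
    exact h _ hlt (π.w_opener _)
  · rintro ⟨b, rfl⟩ j hj hw
    rw [w_opener] at hw
    subst hw
    exact hj.not_ge (π.opener_le j)

/-- An opener, numbered from `0`, counts the letters below it. The rest is again termwise: on the
right of `i`, a block not yet closed spans `i` or is still unopened. -/
theorem MAK'_eq : π.MAK' = BlockWord.rsb π.w ∅ + BlockWord.openerSum π.w := by
  have hsum : ∑ b, (π.opener b : ℕ) = ∑ i, ∑ b, if i < π.opener b then 1 else 0 := by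
    rw [sum_comm]
    refine sum_congr rfl fun b _ => ?_
    rw [← card_filter, filter_gt_eq_Iio, Fin.card_Iio]
  rw [MAK', lob, rcb, BlockWord.rsb, openerSum_eq, hsum, ← sum_add_distrib, ← sum_add_distrib]
  refine sum_congr rfl fun i _ => ?_
  rw [lobAt_eq, rcbAt_eq, ← sum_add_distrib, ← sum_add_distrib]
  refine sum_congr rfl fun b _ => ?_
  simp only [spans_iff]
  have h1 := π.opener_le_closer b
  have h2 : b = π.w i → π.opener b ≤ i := by
    rintro rfl
    exact π.opener_le i
  have h3 : b ≠ π.w i → π.opener b ≠ i := by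
    rintro h rfl
    exact h (π.w_opener b).symm
  grind

/-- The left block of a descent, numbered from `1`, and the right one, numbered from `0`, have the
same number. -/
theorem bMaj_eq : π.bMaj = BlockWord.maj π.w ∅ := by
  rw [bMaj, BlockWord.maj, ← sum_filter]
  refine sum_bij (fun b hb => ⟨b + 1, (mem_filter.mp hb).2.1⟩) ?_ ?_ ?_ (fun _ _ => rfl)
  · intro b hb
    obtain ⟨h, hgt⟩ := (mem_filter.mp hb).2
    simp only [mem_filter, mem_univ, true_and]
    refine ⟨notMem_empty _, b, rfl, fun i j hi hj => ?_⟩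
    exact hgt i ((π.mem_block_iff _ _).mpr hi) j ((π.mem_block_iff _ _).mpr hj)
  · intro b _ c _ h
    exact Fin.ext (Nat.succ_injective (Fin.mk.inj h))
  · intro r hr
    obtain ⟨-, l, hl, h⟩ := (mem_filter.mp hr).2
    refine ⟨l, mem_filter.mpr ⟨mem_univ _, hl ▸ r.2, fun x hx y hy => ?_⟩, Fin.ext hl⟩
    refine h x y ((π.mem_block_iff _ _).mp hx) ?_
    rw [(π.mem_block_iff _ _).mp hy]
    exact Fin.ext hl

theorem cmajLSB_eq :
    π.cmajLSB = BlockWord.lsb π.w ∅ + BlockWord.comaj π.w ∅ + k.choose 2 := by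
  have h := BlockWord.maj_add_comaj π.w ∅
  rw [Fin.sum_univ_eq_sum_range (fun r => r) k, sum_range_id, ← Nat.choose_two_right,
    ← bMaj_eq] at h
  rw [cmajLSB, cbMaj, lsb_eq]
  omega

variable {R : Type*} [CommSemiring R] (p q : R)

theorem partialSum_eq_sum (y z : R) :
    BlockWord.partialSum p q y z n k (fun h => if h = 0 then 1 else 0)
      = ∑ π : OrdPartition n k, BlockWord.weight p q y z π.w ∅ := by
  rw [sum_eq_sum_surjective fun v => BlockWord.weight p q y z v ∅, BlockWord.partialSum]
  refine sum_congr rfl fun v _ => ?_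
  simp [card_eq_zero]

theorem sum_MAK_cmajLSB (n k : ℕ) :
    ∑ π : OrdPartition n k, p ^ (π.MAK + π.bMaj) * q ^ π.cmajLSB
      = q ^ k.choose 2 * pqFactorial p q k * pqStirling p q n k := by
  rw [mul_assoc, ← BlockWord.partialSum_MAK, partialSum_eq_sum, mul_sum]
  refine sum_congr rfl fun π _ => ?_
  rw [MAK_eq, bMaj_eq, cmajLSB_eq, BlockWord.weight, one_pow]
  ring

theorem sum_MAK'_cmajLSB (n k : ℕ) :
    ∑ π : OrdPartition n k, p ^ (π.MAK' + π.bMaj) * q ^ π.cmajLSB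
      = q ^ k.choose 2 * pqFactorial p q k * pqStirling p q n k := by
  rw [mul_assoc, ← BlockWord.partialSum_MAK', partialSum_eq_sum, mul_sum]
  refine sum_congr rfl fun π _ => ?_
  rw [MAK'_eq, bMaj_eq, cmajLSB_eq, BlockWord.weight, one_pow]
  ring

end OrdPartition

/-! ### Setting one variable to `1` -/

section Specialization

variable {R : Type*} [CommSemiring R]

theorem pqNat_one_left (q : R) (k : ℕ) : pqNat 1 q k = qNat q k := by simp [pqNat, qNat]

theorem pqFactorial_one_left (q : R) (k : ℕ) : pqFactorial 1 q k = qFactorial q k :=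
  prod_congr rfl fun j _ => pqNat_one_left q j

theorem pqFactorial_one_right (p : R) (k : ℕ) : pqFactorial p 1 k = qFactorial p k :=
  prod_congr rfl fun j _ => by rw [pqNat_swap, pqNat_one_left]

/-- The reduced Stirling numbers are symmetric in `p` and `q`, so exchanging the variables only
moves the prefactor. -/
theorem pow_choose_two_mul_pqStirling_one_left (q : R) (n k : ℕ) :
    q ^ k.choose 2 * pqStirling 1 q n k = qStirling q n k := by
  rw [qStirling, pqStirling_eq, pqStirling_eq, redStirling_swap, one_pow, one_mul]

end Specialization

theorem theorem3p4 :
    (∀ (R : Type*) [CommSemiring R] (p q : R) (n k : ℕ), 1 ≤ k → k ≤ n →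
      (∑ π : OrdPartition n k, p ^ (π.MAK + π.bMaj) * q ^ π.cmajLSB
          = q ^ k.choose 2 * pqFactorial p q k * pqStirling p q n k) ∧
      (∑ π : OrdPartition n k, p ^ (π.MAK' + π.bMaj) * q ^ π.cmajLSB
          = q ^ k.choose 2 * pqFactorial p q k * pqStirling p q n k)) ∧
    IsEulerMahonian (fun _ _ π => π.MAK + π.bMaj) ∧
    IsEulerMahonian (fun _ _ π => π.MAK' + π.bMaj) ∧
    IsEulerMahonian (fun _ _ π => π.cmajLSB) := by
  refine ⟨fun R _ p q n k _ _ => ⟨OrdPartition.sum_MAK_cmajLSB p q n k,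
    OrdPartition.sum_MAK'_cmajLSB p q n k⟩, fun n k _ _ => ?_, fun n k _ _ => ?_,
    fun n k _ _ => ?_⟩
  · simpa [pqFactorial_one_right, qStirling] using
      OrdPartition.sum_MAK_cmajLSB (X : ℕ[X]) 1 n k
  · simpa [pqFactorial_one_right, qStirling] using
      OrdPartition.sum_MAK'_cmajLSB (X : ℕ[X]) 1 n k
  · have h := OrdPartition.sum_MAK_cmajLSB 1 (X : ℕ[X]) n k
    rw [mul_right_comm, pow_choose_two_mul_pqStirling_one_left, pqFactorial_one_left,
      mul_comm] at h
    simpa using h
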